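/- Let $n,m\ge 1$ be integers and let $q(z,w)=\sum_{j=0}^{n}\sum_{k=0}^{m}a_{j,k}z^jw^k$ be a polynomial in two complex variables of degree at most $(n,m)$, with $a_{j,k}\in\mathbb{C}$. Define its reflection (at the level $(n,m)$) by \[ \tilde q(z,w)=\sum_{j=0}^{n}\sum_{k=0}^{m}\overline{a_{n-j,\,m-k}}\,z^jw^k , \] so that $\tilde q(z,w)=z^nw^m\,\overline{q(1/\bar z,1/\bar w)}$ for $z,w\neq 0$. Then $q$ has no zeros in the closed bidisk $\overline{\mathbb{D}}^2=\{(z,w)\in\mathbb{C}^2:|z|\le 1,\ |w|\le 1\}$ if and only if there exists a constant $c>0$ such that \[ |q(z,w)|^2-|\tilde q(z,w)|^2\ \ge\ c\,(1-|z|^2)(1-|w|^2)\qquad\text{for all }(z,w)\in\overline{\mathbb{D}}^2 . \] Moreover, if $q$ has no zeros in $\overline{\mathbb{D}}^2$, then this inequality holds on $\overline{\mathbb{D}}^2$ with the constant $c>0$ given by \[ \frac1c=\frac{1}{(2\pi i)^2}\int_{\mathbb{T}^2}\frac{1}{|q(z,w)|^2}\,\frac{dz}{z}\,\frac{dw}{w},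 \] where $\mathbb{T}^2=\{(z,w):|z|=|w|=1\}$. -/

import Mathlib

open MvPolynomial

/-- The polynomial `q` in the variables `z = X 0`, `w = X 1` has no zeros in the closed bidisk. -/
def IsStable (q : MvPolynomial (Fin 2) ℂ) : Prop :=
  ∀ z w : ℂ, ‖z‖ ≤ 1 → ‖w‖ ≤ 1 → eval ![z, w] q ≠ 0

/-- The reflection of `q` at the level `(n, m)`:
the polynomial `∑ j ≤ n, ∑ k ≤ m, conj (a (n - j) (m - k)) z ^ j w ^ k`,
where `a j k` is the coefficient of `z ^ j w ^ k` in `q`. -/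
noncomputable def reflection (n m : ℕ) (q : MvPolynomial (Fin 2) ℂ) : MvPolynomial (Fin 2) ℂ :=
  ∑ j ∈ Finset.range (n + 1), ∑ k ∈ Finset.range (m + 1),
    C (starRingEnd ℂ (coeff (Finsupp.single 0 (n - j) + Finsupp.single 1 (m - k)) q)) *
      X 0 ^ j * X 1 ^ k

/-- The inequality `|q|² - |q̃|² ≥ c (1 - |z|²) (1 - |w|²)` on the closed bidisk, where `q̃` is the
reflection of `q` at the level `(n, m)`. -/
def BidiskBound (n m : ℕ) (q : MvPolynomial (Fin 2) ℂ) (c : ℝ) : Prop :=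
  ∀ z w : ℂ, ‖z‖ ≤ 1 → ‖w‖ ≤ 1 →
    c * (1 - ‖z‖ ^ 2) * (1 - ‖w‖ ^ 2) ≤
      ‖eval ![z, w] q‖ ^ 2 - ‖eval ![z, w] (reflection n m q)‖ ^ 2

/-- The integral `(2πi)⁻² ∫ |q(z, w)|⁻² dz/z dw/w` over the 2-torus `|z| = |w| = 1`. -/
noncomputable def torusMeanInv (q : MvPolynomial (Fin 2) ℂ) : ℂ :=
  1 / (2 * (Real.pi : ℂ) * Complex.I) ^ 2 *
    torusIntegral (fun x : Fin 2 → ℂ => 1 / (‖eval x q‖ : ℂ) ^ 2 * (1 / x 0) * (1 / x 1)) 0 1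

/-- A polynomial of degree at most `(n, m)` is `∑ j ≤ n, ∑ k ≤ m, a j k z ^ j w ^ k`. -/
theorem eval_eq_sum_of_degree_le (n m : ℕ) (q : MvPolynomial (Fin 2) ℂ)
    (hz : q.degreeOf 0 ≤ n) (hw : q.degreeOf 1 ≤ m) (z w : ℂ) :
    eval ![z, w] q = ∑ j ∈ Finset.range (n + 1), ∑ k ∈ Finset.range (m + 1),
      coeff (Finsupp.single 0 j + Finsupp.single 1 k) q * z ^ j * w ^ k := by
  have hinj : Function.Injective
      (fun p : ℕ × ℕ => (Finsupp.single 0 p.1 + Finsupp.single 1 p.2 : Fin 2 →₀ ℕ)) := by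
    intro p p' h
    have h0 := DFunLike.congr_fun h 0
    have h1 := DFunLike.congr_fun h 1
    simp at h0 h1
    exact Prod.ext h0 h1
  rw [eval_eq', ← Finset.sum_product']
  have hsub : q.support ⊆ (Finset.range (n + 1) ×ˢ Finset.range (m + 1)).image
      (fun p : ℕ × ℕ => (Finsupp.single 0 p.1 + Finsupp.single 1 p.2 : Fin 2 →₀ ℕ)) := by
    intro d hd
    have h0 := (degreeOf_le_iff.mp hz) d hd
    have h1 := (degreeOf_le_iff.mp hw) d hd
    refine Finset.mem_image.mpr ⟨(d 0, d 1), ?_, ?_⟩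
    · simp only [Finset.mem_product, Finset.mem_range]
      omega
    · ext i
      fin_cases i <;> simp
  rw [Finset.sum_subset hsub, Finset.sum_image (fun _ _ _ _ h => hinj h)]
  · refine Finset.sum_congr rfl fun p _ => ?_
    simp [Fin.prod_univ_two, mul_assoc]
  · intro d _ hd
    rw [notMem_support_iff.mp hd, zero_mul]

/-- Away from the axes, the reflection is `z ^ n w ^ m conj (q (1 / conj z, 1 / conj w))`. -/
theorem eval_reflection (n m : ℕ) (q : MvPolynomial (Fin 2) ℂ)
    (hz : q.degreeOf 0 ≤ n) (hw : q.degreeOf 1 ≤ m) (z w : ℂ) (hz0 : z ≠ 0) (hw0 : w ≠ 0) :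
    eval ![z, w] (reflection n m q) = z ^ n * w ^ m *
      starRingEnd ℂ (eval ![1 / starRingEnd ℂ z, 1 / starRingEnd ℂ w] q) := by
  rw [eval_eq_sum_of_degree_le n m q hz hw, reflection]
  simp only [map_sum, map_mul, map_pow, eval_C, eval_X, Finset.mul_sum, map_div₀, map_one,
    Complex.conj_conj, Matrix.cons_val_zero, Matrix.cons_val_one]
  rw [← Finset.sum_range_reflect]
  refine Finset.sum_congr rfl fun j hj => ?_
  rw [← Finset.sum_range_reflect]
  refine Finset.sum_congr rfl fun k hk => ?_
  simp only [Finset.mem_range] at hj hk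
  have h1 : n - (n + 1 - 1 - j) = j := by omega
  have h2 : m - (m + 1 - 1 - k) = k := by omega
  have h3 : z ^ n = z ^ (n + 1 - 1 - j) * z ^ j := by rw [← pow_add]; congr 1; omega
  have h4 : w ^ m = w ^ (m + 1 - 1 - k) * w ^ k := by rw [← pow_add]; congr 1; omega
  rw [h1, h2, h3, h4]
  simp only [one_div, inv_pow]
  field_simp

/-!
Write `q̃` for the reflection of `q`. If `q` is stable, then `φ = q̃ / q` is holomorphic on the
closed bidisk and unimodular on the torus. There `conj φ / q = conj (zⁿ wᵐ / q)`, so `1 / q` is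
orthogonal to `φ H²` in the Hardy space `H²` of the bidisk. Hence `1 / q` is reproduced by the
kernel `(1 - conj (φ a) φ) k_a` of `H² ⊖ φ H²`, with `k_a` the Szegő kernel. Cauchy–Schwarz gives
`|1 / q(a)|² ≤ ‖1 / q‖² (1 - |φ(a)|²) / ((1 - |a₀|²) (1 - |a₁|²))`, which is the inequality with the
stated constant.

Conversely, if `q` vanishes at a point `x` of the closed bidisk, the inequality fails at `r x` as
`r → 1` from below.
-/

open Set Metric MeasureTheory Filter Topology ComplexConjugate
open scoped Real

section Polydisc

variable {d : ℕ} {E : Type*} [NormedAddCommGroup E] {c : Fin d → ℂ} {R : Fin d → ℝ}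

theorem continuous_torusMap (c : Fin d → ℂ) (R : Fin d → ℝ) : Continuous (torusMap c R) := by
  unfold torusMap
  fun_prop

theorem torusMap_mem_pi_sphere (hR : ∀ i, 0 ≤ R i) (θ : Fin d → ℝ) :
    torusMap c R θ ∈ univ.pi fun i => sphere (c i) (R i) :=
  fun i _ => circleMap_mem_sphere (c i) (hR i) (θ i)

theorem torusIntegrable_of_continuousOn {f : (Fin d → ℂ) → E} (hR : ∀ i, 0 ≤ R i)
    (hf : ContinuousOn f (univ.pi fun i => sphere (c i) (R i))) : TorusIntegrable f c R :=
  (hf.comp_continuous (continuous_torusMap c R)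
    (torusMap_mem_pi_sphere hR)).continuousOn.integrableOn_compact isCompact_Icc

variable [NormedSpace ℂ E] {F : (Fin d → ℂ) → E} {a : Fin d → ℂ}

theorem continuousOn_prod_sub_inv_smul
    (hF : ContinuousOn F (univ.pi fun i => sphere (c i) (R i)))
    (ha : ∀ i, a i ∈ ball (c i) (R i)) :
    ContinuousOn (fun x => (∏ i, (x i - a i)⁻¹) • F x)
      (univ.pi fun i => sphere (c i) (R i)) := by
  refine ContinuousOn.smul ?_ hF
  refine continuousOn_finsetProd _ fun i _ => ContinuousOn.inv₀ (by fun_prop) fun x hx => ?_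
  exact sub_ne_zero.2 (sphere_disjoint_ball.ne_of_mem (hx i trivial) (ha i))

theorem torusIntegral_prod_sub_inv_smul [CompleteSpace E]
    (hF : DifferentiableOn ℂ F (univ.pi fun i => closedBall (c i) (R i)))
    (ha : ∀ i, a i ∈ ball (c i) (R i)) :
    (∯ x in T(c, R), (∏ i, (x i - a i)⁻¹) • F x) = (2 * π * Complex.I : ℂ) ^ d • F a := by
  induction d with
  | zero => simp [Subsingleton.elim c a]
  | succ d ih =>
    have hR (i : Fin (d + 1)) : 0 ≤ R i := (pos_of_mem_ball (ha i)).le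
    have hint : TorusIntegrable (fun x => (∏ i, (x i - a i)⁻¹) • F x) c R :=
      torusIntegrable_of_continuousOn hR (continuousOn_prod_sub_inv_smul
        (hF.continuousOn.mono (pi_mono fun i _ => sphere_subset_closedBall)) ha)
    have hinner : ∀ z ∈ sphere (c 0) (R 0),
        (∯ y in T(c ∘ Fin.succ, R ∘ Fin.succ),
          (∏ i, ((Fin.cons z y : Fin (d + 1) → ℂ) i - a i)⁻¹) • F (Fin.cons z y)) =
        (2 * π * Complex.I : ℂ) ^ d • (z - a 0)⁻¹ • F (Fin.cons z (Fin.tail a)) := by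
      intro z hz
      have hslice : DifferentiableOn ℂ (fun y => (z - a 0)⁻¹ • F (Fin.cons z y))
          (univ.pi fun i => closedBall ((c ∘ Fin.succ) i) ((R ∘ Fin.succ) i)) := by
        refine (hF.comp (by fun_prop) fun y hy => ?_).const_smul _
        exact fun i _ => Fin.cases (sphere_subset_closedBall hz) (fun j => hy j trivial) i
      rw [← ih (a := Fin.tail a) hslice fun i => ha i.succ]
      simp [Fin.prod_univ_succ, smul_smul, mul_comm, Fin.tail]
    have houter : DifferentiableOn ℂ (fun z => F (Fin.cons z (Fin.tail a)))
        (closedBall (c 0) (R 0)) := by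
      refine hF.comp (by fun_prop) fun z hz => ?_
      exact fun i _ => Fin.cases hz (fun j => ball_subset_closedBall (ha j.succ)) i
    rw [torusIntegral_succ hint, circleIntegral.integral_congr (hR 0) hinner,
      circleIntegral.integral_smul, houter.circleIntegral_sub_inv_smul (ha 0), smul_smul,
      ← pow_succ, Fin.cons_self_tail]

end Polydisc

theorem sq_norm_integral_inner_le {α 𝕜 E : Type*} [MeasurableSpace α] {μ : Measure α} [RCLike 𝕜]
    [NormedAddCommGroup E] [InnerProductSpace 𝕜 E] {f g : α → E} (hf : MemLp f 2 μ)
    (hg : MemLp g 2 μ) :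
    ‖∫ x, inner 𝕜 (f x) (g x) ∂μ‖ ^ 2 ≤ (∫ x, ‖f x‖ ^ 2 ∂μ) * ∫ x, ‖g x‖ ^ 2 ∂μ := by
  have hHolder : ∫ x, ‖f x‖ * ‖g x‖ ∂μ ≤ √((∫ x, ‖f x‖ ^ 2 ∂μ) * ∫ x, ‖g x‖ ^ 2 ∂μ) := by
    have := integral_mul_norm_le_Lp_mul_Lq (μ := μ) (f := fun x => ‖f x‖) (g := fun x => ‖g x‖)
      Real.HolderConjugate.two_two (by simpa using hf.norm) (by simpa using hg.norm)
    simpa only [norm_norm, Real.rpow_two, ← Real.sqrt_eq_rpow,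
      ← Real.sqrt_mul (integral_nonneg fun x => sq_nonneg ‖f x‖)] using this
  rw [← Real.le_sqrt (norm_nonneg _)
    (mul_nonneg (integral_nonneg fun _ => by positivity) (integral_nonneg fun _ => by positivity))]
  refine (norm_integral_le_of_norm_le (hf.norm.integrable_mul hg.norm) ?_).trans hHolder
  exact Eventually.of_forall fun x => norm_inner_le_norm _ _

section UnitTorus

variable {d : ℕ}

/-- The unit torus `|x 0| = ⋯ = |x (d - 1)| = 1`, the distinguished boundary of the unit polydisc
`closedBall 0 1`. -/
def unitTorus (d : ℕ) : Set (Fin d → ℂ) := univ.pi fun _ => sphere 0 1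

theorem norm_of_mem_unitTorus {x : Fin d → ℂ} (hx : x ∈ unitTorus d) (i : Fin d) : ‖x i‖ = 1 :=
  mem_sphere_zero_iff_norm.1 (hx i trivial)

theorem conj_of_mem_unitTorus {x : Fin d → ℂ} (hx : x ∈ unitTorus d) (i : Fin d) :
    conj (x i) = (x i)⁻¹ :=
  (Complex.inv_eq_conj (norm_of_mem_unitTorus hx i)).symm

theorem unitTorus_subset_closedBall : unitTorus d ⊆ closedBall 0 1 := fun _ hx =>
  mem_closedBall_zero_iff.2 <| (pi_norm_le_iff_of_nonneg zero_le_one).2 fun i =>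
    (norm_of_mem_unitTorus hx i).le

theorem isCompact_unitTorus : IsCompact (unitTorus d) :=
  isCompact_univ_pi fun _ => isCompact_sphere 0 1

/-- The normalized Lebesgue (Haar) measure on the unit torus, as a measure on `Fin d → ℂ`. -/
noncomputable def unitTorusMeasure (d : ℕ) : Measure (Fin d → ℂ) :=
  (ProbabilityTheory.cond volume (Icc 0 fun _ => 2 * π)).map (torusMap 0 1)

instance : IsFiniteMeasure (unitTorusMeasure d) := by
  unfold unitTorusMeasure
  infer_instance

theorem ae_mem_unitTorus : ∀ᵐ x ∂unitTorusMeasure d, x ∈ unitTorus d :=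
  (ae_map_iff (continuous_torusMap 0 1).aemeasurable isCompact_unitTorus.measurableSet).2 <|
    Eventually.of_forall <| torusMap_mem_pi_sphere fun _ => zero_le_one

theorem integral_unitTorusMeasure_congr {E : Type*} [NormedAddCommGroup E] [NormedSpace ℝ E]
    {f g : (Fin d → ℂ) → E} (h : EqOn f g (unitTorus d)) :
    ∫ x, f x ∂unitTorusMeasure d = ∫ x, g x ∂unitTorusMeasure d :=
  integral_congr_ae (ae_mem_unitTorus.mono h)

theorem integrable_unitTorusMeasure {E : Type*} [NormedAddCommGroup E] {f : (Fin d → ℂ) → E}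
    (hf : ContinuousOn f (unitTorus d)) : Integrable f (unitTorusMeasure d) := by
  rw [← Measure.restrict_eq_self_of_ae_mem (ae_mem_unitTorus (d := d))]
  exact hf.integrableOn_compact isCompact_unitTorus

theorem memLp_two_unitTorusMeasure {E : Type*} [NormedAddCommGroup E] {f : (Fin d → ℂ) → E}
    (hf : ContinuousOn f (unitTorus d)) : MemLp f 2 (unitTorusMeasure d) :=
  (memLp_two_iff_integrable_sq_norm (integrable_unitTorusMeasure hf).1).2
    (integrable_unitTorusMeasure (hf.norm.pow 2))

theorem torusIntegral_eq_integral_unitTorusMeasure {E : Type*} [NormedAddCommGroup E]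
    [NormedSpace ℂ E] {f : (Fin d → ℂ) → E} (hf : ContinuousOn f (unitTorus d)) :
    (∯ x in T(0, 1), f x) =
      (2 * π * Complex.I : ℂ) ^ d • ∫ x, (∏ i, x i) • f x ∂unitTorusMeasure d := by
  have hprod (θ : Fin d → ℝ) :
      ∏ i, ((1 : Fin d → ℝ) i : ℂ) * Complex.exp (θ i * Complex.I) * Complex.I =
        Complex.I ^ d * ∏ i, torusMap 0 1 θ i := by
    simp [torusMap, Finset.prod_mul_distrib, mul_comm]
  have hvol : (volume (Icc (0 : Fin d → ℝ) fun _ => 2 * π)).toReal = (2 * π) ^ d := by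
    simp [Real.volume_Icc_pi, Real.pi_pos.le]
  have hmeas := (integrable_unitTorusMeasure (f := fun x => (∏ i, x i) • f x)
    (by fun_prop)).aestronglyMeasurable
  rw [torusIntegral, unitTorusMeasure,
    integral_map (continuous_torusMap 0 1).aemeasurable hmeas, ProbabilityTheory.cond,
    integral_smul_measure, ENNReal.toReal_inv, hvol, ← Complex.coe_smul, smul_smul]
  simp only [hprod, mul_smul, integral_smul]
  rw [smul_smul]
  congr 1
  push_cast
  rw [mul_pow]
  field_simp

end UnitTorus

section SzegoKernel

variable {d : ℕ} {a : Fin d → ℂ} {f g φ : (Fin d → ℂ) → ℂ}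

/-- The Szegő kernel of the unit polydisc, as a function of `x`: the reproducing kernel at `a` of
the Hardy space. -/
noncomputable def szegoKernel (a x : Fin d → ℂ) : ℂ :=
  ∏ i, (1 - conj (a i) * x i)⁻¹

theorem szegoKernel_self : szegoKernel a a = ((∏ i, (1 - ‖a i‖ ^ 2) : ℝ) : ℂ)⁻¹ := by
  simp [szegoKernel, Complex.conj_mul']

theorem conj_szegoKernel {x : Fin d → ℂ} (hx : x ∈ unitTorus d) :
    conj (szegoKernel a x) = ∏ i, x i * (x i - a i)⁻¹ := by
  simp only [szegoKernel, map_prod, map_inv₀, map_sub, map_one, map_mul, Complex.conj_conj]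
  refine Finset.prod_congr rfl fun i _ => ?_
  have hxi : x i ≠ 0 := norm_ne_zero_iff.1 (by simp [norm_of_mem_unitTorus hx])
  have hfactor : 1 - a i * (x i)⁻¹ = (x i)⁻¹ * (x i - a i) := by field_simp
  rw [conj_of_mem_unitTorus hx, hfactor, mul_inv, inv_inv]

theorem differentiableOn_szegoKernel (ha : a ∈ ball 0 1) :
    DifferentiableOn ℂ (szegoKernel a) (closedBall 0 1) := by
  intro x hx
  have hne (i : Fin d) : 1 - conj (a i) * x i ≠ 0 := by
    have hlt : ‖conj (a i) * x i‖ < 1 := by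
      rw [norm_mul, RCLike.norm_conj]
      exact mul_lt_one_of_nonneg_of_lt_one_left (norm_nonneg _)
        ((norm_le_pi_norm a i).trans_lt (mem_ball_zero_iff.1 ha))
        ((norm_le_pi_norm x i).trans (mem_closedBall_zero_iff.1 hx))
    intro h
    rw [← sub_eq_zero.1 h, norm_one] at hlt
    exact hlt.false
  have hfactor (i : Fin d) : DifferentiableWithinAt ℂ
      (fun y : Fin d → ℂ => (1 - conj (a i) * y i)⁻¹) (closedBall 0 1) x :=
    DifferentiableWithinAt.fun_inv (by fun_prop) (hne i)
  exact (HasFDerivWithinAt.finsetProd fun i _ =>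
    (hfactor i).hasFDerivWithinAt).differentiableWithinAt

theorem integral_mul_conj_szegoKernel (hf : DifferentiableOn ℂ f (closedBall 0 1))
    (ha : a ∈ ball 0 1) :
    ∫ x, f x * conj (szegoKernel a x) ∂unitTorusMeasure d = f a := by
  have hpoly : closedBall (0 : Fin d → ℂ) 1 = univ.pi fun _ => closedBall 0 1 :=
    closedBall_pi 0 zero_le_one
  have hai (i : Fin d) : a i ∈ ball 0 1 :=
    mem_ball_zero_iff.2 ((norm_le_pi_norm a i).trans_lt (mem_ball_zero_iff.1 ha))
  have hcauchy := torusIntegral_prod_sub_inv_smul (c := 0) (R := 1) (hpoly ▸ hf) hai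
  rw [torusIntegral_eq_integral_unitTorusMeasure (continuousOn_prod_sub_inv_smul
    (hf.continuousOn.mono unitTorus_subset_closedBall) hai)] at hcauchy
  rw [← smul_right_injective ℂ (pow_ne_zero d Complex.two_pi_I_ne_zero) hcauchy]
  refine integral_unitTorusMeasure_congr fun x hx => ?_
  simp only [conj_szegoKernel hx, Finset.prod_mul_distrib, smul_eq_mul]
  ring

theorem integral_unitTorusMeasure_eq_apply_zero (hf : DifferentiableOn ℂ f (closedBall 0 1)) :
    ∫ x, f x ∂unitTorusMeasure d = f 0 := by
  rw [← integral_mul_conj_szegoKernel hf (mem_ball_self one_pos)]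
  simp [szegoKernel]

/-- For `φ` of modulus one on the unit torus, the reproducing kernel at `a` of the orthogonal
complement of `φ H²` in the Hardy space `H²` of the unit polydisc, as a function of `x`. -/
noncomputable def modelKernel (φ : (Fin d → ℂ) → ℂ) (a x : Fin d → ℂ) : ℂ :=
  (1 - conj (φ a) * φ x) * szegoKernel a x

theorem differentiableOn_modelKernel (hφ : DifferentiableOn ℂ φ (closedBall 0 1))
    (ha : a ∈ ball 0 1) : DifferentiableOn ℂ (modelKernel φ a) (closedBall 0 1) :=
  ((hφ.const_mul _).const_sub 1).mul (differentiableOn_szegoKernel ha)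

theorem modelKernel_self :
    modelKernel φ a a = (((1 - ‖φ a‖ ^ 2) / ∏ i, (1 - ‖a i‖ ^ 2) : ℝ) : ℂ) := by
  rw [modelKernel, szegoKernel_self, Complex.conj_mul']
  push_cast
  rfl

theorem integral_mul_conj_modelKernel (hφ : DifferentiableOn ℂ φ (closedBall 0 1))
    (hf : DifferentiableOn ℂ f (closedBall 0 1)) (ha : a ∈ ball 0 1)
    (horth : ∫ x, f x * conj (φ x * szegoKernel a x) ∂unitTorusMeasure d = 0) :
    ∫ x, f x * conj (modelKernel φ a x) ∂unitTorusMeasure d = f a := by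
  have hf' := hf.continuousOn.mono unitTorus_subset_closedBall
  have hφ' := hφ.continuousOn.mono unitTorus_subset_closedBall
  have hK := (differentiableOn_szegoKernel ha).continuousOn.mono unitTorus_subset_closedBall
  have hsplit (x : Fin d → ℂ) : f x * conj (modelKernel φ a x) =
      f x * conj (szegoKernel a x) - φ a * (f x * conj (φ x * szegoKernel a x)) := by
    simp only [modelKernel, map_mul, map_sub, map_one, Complex.conj_conj]
    ring
  simp only [hsplit]
  rw [integral_sub (integrable_unitTorusMeasure (by fun_prop))
    (integrable_unitTorusMeasure (by fun_prop)), integral_const_mul, horth, mul_zero, sub_zero,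
    integral_mul_conj_szegoKernel hf ha]

theorem integral_modelKernel_mul_conj_eq_zero (hφ : DifferentiableOn ℂ φ (closedBall 0 1))
    (hφ_norm : ∀ x ∈ unitTorus d, ‖φ x‖ = 1) (ha : a ∈ ball 0 1) :
    ∫ x, modelKernel φ a x * conj (φ x * szegoKernel a x) ∂unitTorusMeasure d = 0 := by
  have hconj : EqOn (fun x => modelKernel φ a x * conj (φ x * szegoKernel a x))
      (fun x => conj ((φ x - φ a) * szegoKernel a x * conj (szegoKernel a x)))
      (unitTorus d) := by
    intro x hx
    have hφx : φ x * conj (φ x) = 1 := by simp [Complex.mul_conj', hφ_norm x hx]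
    simp only [modelKernel, map_mul, map_sub, Complex.conj_conj]
    linear_combination -conj (φ a) * szegoKernel a x * conj (szegoKernel a x) * hφx
  rw [integral_unitTorusMeasure_congr hconj, integral_conj,
    integral_mul_conj_szegoKernel ((hφ.sub_const _).fun_mul (differentiableOn_szegoKernel ha)) ha]
  simp

theorem integral_norm_sq_modelKernel (hφ : DifferentiableOn ℂ φ (closedBall 0 1))
    (hφ_norm : ∀ x ∈ unitTorus d, ‖φ x‖ = 1) (ha : a ∈ ball 0 1) :
    ∫ x, ‖modelKernel φ a x‖ ^ 2 ∂unitTorusMeasure d =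
      (1 - ‖φ a‖ ^ 2) / ∏ i, (1 - ‖a i‖ ^ 2) := by
  rw [← Complex.ofReal_inj, ← modelKernel_self, ← integral_complex_ofReal]
  push_cast
  simp only [← Complex.mul_conj']
  exact integral_mul_conj_modelKernel hφ (differentiableOn_modelKernel hφ ha) ha
    (integral_modelKernel_mul_conj_eq_zero hφ hφ_norm ha)

/-- The hypothesis on `g` says that `f` is orthogonal to `φ H²`; the inequality is then
Cauchy–Schwarz for `f` and the reproducing kernel of the orthogonal complement of `φ H²`. -/
theorem norm_sq_mul_prod_le_integral_mul (hφ : DifferentiableOn ℂ φ (closedBall 0 1))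
    (hφ_norm : ∀ x ∈ unitTorus d, ‖φ x‖ = 1) (hf : DifferentiableOn ℂ f (closedBall 0 1))
    (hg : DifferentiableOn ℂ g (closedBall 0 1)) (hg0 : g 0 = 0)
    (hfg : ∀ x ∈ unitTorus d, f x * conj (φ x) = conj (g x)) (ha : a ∈ ball 0 1) :
    ‖f a‖ ^ 2 * ∏ i, (1 - ‖a i‖ ^ 2) ≤
      (∫ x, ‖f x‖ ^ 2 ∂unitTorusMeasure d) * (1 - ‖φ a‖ ^ 2) := by
  have horth : ∫ x, f x * conj (φ x * szegoKernel a x) ∂unitTorusMeasure d = 0 := by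
    have hconj : EqOn (fun x => f x * conj (φ x * szegoKernel a x))
        (fun x => conj (g x * szegoKernel a x)) (unitTorus d) := fun x hx => by
      simp only [map_mul, ← mul_assoc, hfg x hx]
    rw [integral_unitTorusMeasure_congr hconj, integral_conj,
      integral_unitTorusMeasure_eq_apply_zero (hg.fun_mul (differentiableOn_szegoKernel ha))]
    simp [hg0]
  have hprod : 0 < ∏ i, (1 - ‖a i‖ ^ 2) := Finset.prod_pos fun i _ => by
    have := (norm_le_pi_norm a i).trans_lt (mem_ball_zero_iff.1 ha)
    exact sub_pos.2 (pow_lt_one₀ (norm_nonneg _) this two_ne_zero)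
  have hk := (differentiableOn_modelKernel hφ ha).continuousOn.mono unitTorus_subset_closedBall
  have hCS := sq_norm_integral_inner_le (𝕜 := ℂ) (memLp_two_unitTorusMeasure hk)
    (memLp_two_unitTorusMeasure (hf.continuousOn.mono unitTorus_subset_closedBall))
  simp only [RCLike.inner_apply, integral_mul_conj_modelKernel hφ hf ha horth,
    integral_norm_sq_modelKernel hφ hφ_norm ha] at hCS
  rwa [div_mul_eq_mul_div, le_div_iff₀ hprod, mul_comm (1 - _)] at hCS

end SzegoKernel

section StablePolynomial

variable {n m : ℕ} {q : MvPolynomial (Fin 2) ℂ}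

theorem forall_mem_closedBall_fin_two_iff {E : Type*} [SeminormedAddCommGroup E] {r : ℝ}
    (hr : 0 ≤ r) {P : (Fin 2 → E) → Prop} :
    (∀ x ∈ closedBall (0 : Fin 2 → E) r, P x) ↔ ∀ z w, ‖z‖ ≤ r → ‖w‖ ≤ r → P ![z, w] := by
  simp only [mem_closedBall_zero_iff, pi_norm_le_iff_of_nonneg hr, Fin.forall_fin_two,
    and_imp]
  refine ⟨fun h z w hz hw => h _ hz hw, fun h x h0 h1 => ?_⟩
  have hx : ![x 0, x 1] = x := funext (Fin.forall_fin_two.2 ⟨rfl, rfl⟩)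
  exact hx ▸ h _ _ h0 h1

theorem isStable_iff : IsStable q ↔ ∀ x ∈ closedBall 0 1, eval x q ≠ 0 :=
  (forall_mem_closedBall_fin_two_iff zero_le_one (P := fun x => eval x q ≠ 0)).symm

theorem bidiskBound_iff {c : ℝ} :
    BidiskBound n m q c ↔ ∀ x ∈ closedBall (0 : Fin 2 → ℂ) 1,
      c * ∏ i, (1 - ‖x i‖ ^ 2) ≤ ‖eval x q‖ ^ 2 - ‖eval x (reflection n m q)‖ ^ 2 := by
  rw [forall_mem_closedBall_fin_two_iff zero_le_one]
  simp [BidiskBound, Fin.prod_univ_two, mul_assoc]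

theorem differentiable_eval {σ 𝕜 : Type*} [Finite σ] [NontriviallyNormedField 𝕜]
    [CompleteSpace 𝕜] (p : MvPolynomial σ 𝕜) : Differentiable 𝕜 fun x : σ → 𝕜 => eval x p := by
  cases nonempty_fintype σ
  exact fun x => (AnalyticOnNhd.eval_mvPolynomial p x trivial).differentiableAt

theorem eval_smul_reflection (hz : q.degreeOf 0 ≤ n) (hw : q.degreeOf 1 ≤ m) {x : Fin 2 → ℂ}
    (hx : x ∈ unitTorus 2) {r : ℝ} (hr : r ≠ 0) :
    eval (r • x) (reflection n m q) =
      r ^ (n + m) * (x 0 ^ n * x 1 ^ m) * conj (eval (r⁻¹ • x) q) := by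
  have hne (i : Fin 2) : r * x i ≠ 0 :=
    mul_ne_zero (Complex.ofReal_ne_zero.2 hr) (norm_ne_zero_iff.1 (by
      simp [norm_of_mem_unitTorus hx]))
  have hinv (i : Fin 2) : 1 / conj (r * x i) = r⁻¹ * x i := by
    simp [conj_of_mem_unitTorus hx, mul_comm]
  have hsmul (s : ℝ) : s • x = ![s * x 0, s * x 1] :=
    funext (Fin.forall_fin_two.2 ⟨rfl, rfl⟩)
  rw [hsmul, hsmul, eval_reflection n m q hz hw _ _ (hne 0) (hne 1), hinv, hinv]
  push_cast
  ring

theorem eval_reflection_of_mem_unitTorus (hz : q.degreeOf 0 ≤ n) (hw : q.degreeOf 1 ≤ m)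
    {x : Fin 2 → ℂ} (hx : x ∈ unitTorus 2) :
    eval x (reflection n m q) = x 0 ^ n * x 1 ^ m * conj (eval x q) := by
  simpa using eval_smul_reflection hz hw hx one_ne_zero

theorem norm_eval_smul_reflection (hz : q.degreeOf 0 ≤ n) (hw : q.degreeOf 1 ≤ m)
    {x : Fin 2 → ℂ} (hx : x ∈ unitTorus 2) {r : ℝ} (hr : r ≠ 0) :
    ‖eval (r • x) (reflection n m q)‖ = ‖r ^ (n + m) • eval (r⁻¹ • x) q‖ := by
  simp [eval_smul_reflection hz hw hx hr, norm_of_mem_unitTorus hx]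

theorem torusMeanInv_eq_integral (hq : ∀ x ∈ unitTorus 2, eval x q ≠ 0) :
    torusMeanInv q = ((∫ x, ‖(eval x q)⁻¹‖ ^ 2 ∂unitTorusMeasure 2 : ℝ) : ℂ) := by
  have hx0 : ∀ x ∈ unitTorus 2, ∀ i, x i ≠ 0 := fun x hx i =>
    norm_ne_zero_iff.1 (by simp [norm_of_mem_unitTorus hx])
  have hcont : ContinuousOn
      (fun x : Fin 2 → ℂ => 1 / (‖eval x q‖ : ℂ) ^ 2 * (1 / x 0) * (1 / x 1)) (unitTorus 2) := by
    have hq_cont : Continuous fun x : Fin 2 → ℂ => (‖eval x q‖ : ℂ) :=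
      Complex.continuous_ofReal.comp (continuous_eval q).norm
    have hq_sq : ∀ x ∈ unitTorus 2, (‖eval x q‖ : ℂ) ^ 2 ≠ 0 := fun x hx => by simp [hq x hx]
    refine ((continuousOn_const.div (hq_cont.pow 2).continuousOn hq_sq).mul ?_).mul ?_ <;>
      exact continuousOn_const.div (by fun_prop) fun x hx => hx0 x hx _
  rw [torusMeanInv, torusIntegral_eq_integral_unitTorusMeasure hcont, smul_eq_mul, ← mul_assoc,
    one_div_mul_cancel (pow_ne_zero 2 Complex.two_pi_I_ne_zero), one_mul,
    ← integral_complex_ofReal]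
  refine integral_unitTorusMeasure_congr fun x hx => ?_
  have h0 := hx0 x hx 0
  have h1 := hx0 x hx 1
  simp only [Fin.prod_univ_two, smul_eq_mul, norm_inv, inv_pow, Complex.ofReal_inv,
    Complex.ofReal_pow]
  field_simp

theorem prod_one_sub_norm_sq_le_integral_mul_of_mem_ball (hnm : n + m ≠ 0) (hz : q.degreeOf 0 ≤ n)
    (hw : q.degreeOf 1 ≤ m) (hq : ∀ x ∈ closedBall 0 1, eval x q ≠ 0) {a : Fin 2 → ℂ}
    (ha : a ∈ ball 0 1) :
    ∏ i, (1 - ‖a i‖ ^ 2) ≤ (∫ x, ‖(eval x q)⁻¹‖ ^ 2 ∂unitTorusMeasure 2) *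
      (‖eval a q‖ ^ 2 - ‖eval a (reflection n m q)‖ ^ 2) := by
  have hf : DifferentiableOn ℂ (fun x => (eval x q)⁻¹) (closedBall 0 1) :=
    (differentiable_eval q).differentiableOn.inv hq
  have hφ : DifferentiableOn ℂ (fun x => eval x (reflection n m q) * (eval x q)⁻¹)
      (closedBall 0 1) :=
    (differentiable_eval _).differentiableOn.fun_mul hf
  have hφ_norm : ∀ x ∈ unitTorus 2, ‖eval x (reflection n m q) * (eval x q)⁻¹‖ = 1 := by
    intro x hx
    have hqx : eval x q ≠ 0 := hq x (unitTorus_subset_closedBall hx)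
    simp [eval_reflection_of_mem_unitTorus hz hw hx, norm_of_mem_unitTorus hx, hqx]
  have hg : DifferentiableOn ℂ (fun x : Fin 2 → ℂ => x 0 ^ n * x 1 ^ m * (eval x q)⁻¹)
      (closedBall 0 1) :=
    DifferentiableOn.fun_mul (by fun_prop) hf
  have hg0 : (0 : Fin 2 → ℂ) 0 ^ n * (0 : Fin 2 → ℂ) 1 ^ m * (eval 0 q)⁻¹ = 0 := by
    rw [Pi.zero_apply, Pi.zero_apply, ← pow_add, zero_pow hnm, zero_mul]
  have hfg : ∀ x ∈ unitTorus 2,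
      (eval x q)⁻¹ * conj (eval x (reflection n m q) * (eval x q)⁻¹) =
        conj (x 0 ^ n * x 1 ^ m * (eval x q)⁻¹) := by
    intro x hx
    have hqx : eval x q ≠ 0 := hq x (unitTorus_subset_closedBall hx)
    simp only [eval_reflection_of_mem_unitTorus hz hw hx, map_mul, Complex.conj_conj]
    field_simp
  have hbound := norm_sq_mul_prod_le_integral_mul hφ hφ_norm hf hg hg0 hfg ha
  have hqa : 0 < ‖eval a q‖ := norm_pos_iff.2 (hq a (ball_subset_closedBall ha))
  rw [norm_mul, norm_inv, ← mul_le_mul_iff_right₀ (pow_pos hqa 2)] at hbound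
  generalize ∫ x, ‖(eval x q)⁻¹‖ ^ 2 ∂unitTorusMeasure 2 = M at hbound ⊢
  field_simp at hbound
  exact hbound

theorem prod_one_sub_norm_sq_le_integral_mul (hnm : n + m ≠ 0) (hz : q.degreeOf 0 ≤ n)
    (hw : q.degreeOf 1 ≤ m) (hq : ∀ x ∈ closedBall 0 1, eval x q ≠ 0) {a : Fin 2 → ℂ}
    (ha : a ∈ closedBall 0 1) :
    ∏ i, (1 - ‖a i‖ ^ 2) ≤ (∫ x, ‖(eval x q)⁻¹‖ ^ 2 ∂unitTorusMeasure 2) *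
      (‖eval a q‖ ^ 2 - ‖eval a (reflection n m q)‖ ^ 2) := by
  rw [← closure_ball 0 one_ne_zero] at ha
  have hcont (p : MvPolynomial (Fin 2) ℂ) : Continuous fun x : Fin 2 → ℂ => eval x p :=
    continuous_eval p
  have hclosed := isClosed_le (f := fun a : Fin 2 → ℂ => ∏ i, (1 - ‖a i‖ ^ 2))
    (g := fun a => (∫ x, ‖(eval x q)⁻¹‖ ^ 2 ∂unitTorusMeasure 2) *
      (‖eval a q‖ ^ 2 - ‖eval a (reflection n m q)‖ ^ 2)) (by fun_prop) (by fun_prop)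
  exact closure_minimal
    (fun x hx => prod_one_sub_norm_sq_le_integral_mul_of_mem_ball hnm hz hw hq hx) hclosed ha

theorem exists_bidiskBound_of_isStable (hnm : n + m ≠ 0) (hz : q.degreeOf 0 ≤ n)
    (hw : q.degreeOf 1 ≤ m) (hq : IsStable q) :
    ∃ c : ℝ, 0 < c ∧ 1 / (c : ℂ) = torusMeanInv q ∧ BidiskBound n m q c := by
  rw [isStable_iff] at hq
  have hmean := torusMeanInv_eq_integral fun x hx => hq x (unitTorus_subset_closedBall hx)
  set M := ∫ x, ‖(eval x q)⁻¹‖ ^ 2 ∂unitTorusMeasure 2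
  have hbound : ∀ a ∈ closedBall (0 : Fin 2 → ℂ) 1, ∏ i, (1 - ‖a i‖ ^ 2) ≤
      M * (‖eval a q‖ ^ 2 - ‖eval a (reflection n m q)‖ ^ 2) := fun a =>
    prod_one_sub_norm_sq_le_integral_mul hnm hz hw hq
  have hM : 0 < M := by
    have hM0 : 0 ≤ M := integral_nonneg fun x => by positivity
    refine hM0.lt_of_ne' fun h => ?_
    simpa [h, not_le.2 one_pos] using hbound 0 (mem_closedBall_self zero_le_one)
  refine ⟨M⁻¹, inv_pos.2 hM, by simp [hmean], bidiskBound_iff.2 fun a ha => ?_⟩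
  rw [← div_eq_inv_mul, div_le_iff₀' hM]
  exact hbound a ha

end StablePolynomial

section RadialLimit

theorem tendsto_norm_sq_div_sq_of_hasDerivAt {E : Type*} [NormedAddCommGroup E]
    [NormedSpace ℝ E] {f : ℝ → E} {f' : E} {x : ℝ} (hf : HasDerivAt f f' x) (hx : f x = 0) :
    Tendsto (fun r => ‖f r‖ ^ 2 / (r - x) ^ 2) (𝓝[≠] x) (𝓝 (‖f'‖ ^ 2)) := by
  refine ((hasDerivAt_iff_tendsto_slope.1 hf).norm.pow 2).congr fun r => ?_
  rw [slope_def_module, hx, sub_zero, norm_smul, mul_pow, norm_inv, inv_pow, Real.norm_eq_abs,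
    sq_abs, inv_mul_eq_div]

theorem tendsto_norm_sq_sub_norm_sq_reflection {E : Type*} [NormedAddCommGroup E]
    [NormedSpace ℝ E] {g : ℝ → E} (hg : DifferentiableAt ℝ g 1) (hg1 : g 1 = 0) (N : ℕ) :
    Tendsto (fun r => (‖g r‖ ^ 2 - ‖r ^ N • g r⁻¹‖ ^ 2) / (r - 1) ^ 2) (𝓝[≠] 1) (𝓝 0) := by
  have hinv : HasDerivAt (fun r : ℝ => g r⁻¹) (-deriv g 1) 1 := by
    simpa [Function.comp_def] using
      hg.hasDerivAt.scomp_of_eq 1 (hasDerivAt_inv one_ne_zero) inv_one.symm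
  have hrefl : HasDerivAt (fun r : ℝ => r ^ N • g r⁻¹) (-deriv g 1) 1 := by
    simpa [hg1] using (hasDerivAt_pow N (1 : ℝ)).fun_smul hinv
  have := (tendsto_norm_sq_div_sq_of_hasDerivAt hg.hasDerivAt hg1).sub
    (tendsto_norm_sq_div_sq_of_hasDerivAt hrefl (by simp [hg1]))
  simpa only [norm_neg, sub_self, sub_div] using this

variable {n m : ℕ} {q : MvPolynomial (Fin 2) ℂ} {c : ℝ} {x : Fin 2 → ℂ}

theorem differentiableAt_eval_smul (q : MvPolynomial (Fin 2) ℂ) (x : Fin 2 → ℂ) (r : ℝ) :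
    DifferentiableAt ℝ (fun s : ℝ => eval (s • x) q) r :=
  DifferentiableAt.comp (g := fun y : Fin 2 → ℂ => eval y q) r
    (((differentiable_eval q).restrictScalars ℝ) (r • x)) (by fun_prop)

theorem BidiskBound.le_radial (hb : BidiskBound n m q c) (hx : x ∈ closedBall 0 1) {r : ℝ}
    (hr : r ∈ Ioo (0 : ℝ) 1) :
    c * ((1 - r ^ 2 * ‖x 0‖ ^ 2) * (1 - r ^ 2 * ‖x 1‖ ^ 2)) ≤
      ‖eval (r • x) q‖ ^ 2 - ‖eval (r • x) (reflection n m q)‖ ^ 2 := by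
  have hrx : r • x ∈ closedBall (0 : Fin 2 → ℂ) 1 := by
    rw [mem_closedBall_zero_iff, norm_smul, Real.norm_of_nonneg hr.1.le]
    exact mul_le_one₀ hr.2.le (norm_nonneg x) (mem_closedBall_zero_iff.1 hx)
  simpa [Fin.prod_univ_two, mul_pow] using bidiskBound_iff.1 hb _ hrx

theorem one_sub_mul_one_sub_mul_le {ρ s t : ℝ} (hρ : 0 ≤ ρ) (hs : s ∈ Icc (0 : ℝ) 1)
    (ht : t ∈ Icc (0 : ℝ) 1) : (1 - ρ) * (1 - s * t) ≤ (1 - ρ * s) * (1 - ρ * t) := by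
  have h₁ : 0 ≤ ρ * ((1 - s) * (1 - t)) :=
    mul_nonneg hρ (mul_nonneg (sub_nonneg.2 hs.2) (sub_nonneg.2 ht.2))
  have h₂ : 0 ≤ s * t * (1 - ρ) ^ 2 := mul_nonneg (mul_nonneg hs.1 ht.1) (sq_nonneg _)
  linarith

theorem norm_sq_mul_norm_sq_lt_one_of_notMem_unitTorus (hx : x ∈ closedBall 0 1)
    (hxT : x ∉ unitTorus 2) : ‖x 0‖ ^ 2 * ‖x 1‖ ^ 2 < 1 := by
  have hxi (i : Fin 2) : ‖x i‖ ≤ 1 := (norm_le_pi_norm x i).trans (mem_closedBall_zero_iff.1 hx)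
  have hsq (i : Fin 2) : ‖x i‖ ^ 2 ≤ 1 := pow_le_one₀ (norm_nonneg _) (hxi i)
  by_contra! h
  have hone : ∀ i, 1 ≤ ‖x i‖ ^ 2 :=
    Fin.forall_fin_two.2 ⟨h.trans (mul_le_of_le_one_right (sq_nonneg _) (hsq 1)),
      h.trans (mul_le_of_le_one_left (sq_nonneg _) (hsq 0))⟩
  exact hxT fun i _ => mem_sphere_zero_iff_norm.2
    ((hxi i).antisymm ((one_le_sq_iff₀ (norm_nonneg _)).1 (hone i)))

theorem BidiskBound.mul_one_sub_le_norm_sq (hc : 0 ≤ c) (hb : BidiskBound n m q c)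
    (hx : x ∈ closedBall 0 1) {r : ℝ} (hr : r ∈ Ioo (0 : ℝ) 1) :
    c * (1 - ‖x 0‖ ^ 2 * ‖x 1‖ ^ 2) * (1 - r) ≤ ‖eval (r • x) q‖ ^ 2 := by
  have hsq (i : Fin 2) : ‖x i‖ ^ 2 ∈ Icc (0 : ℝ) 1 :=
    ⟨sq_nonneg _, pow_le_one₀ (norm_nonneg _)
      ((norm_le_pi_norm x i).trans (mem_closedBall_zero_iff.1 hx))⟩
  have hgap : 0 ≤ 1 - ‖x 0‖ ^ 2 * ‖x 1‖ ^ 2 :=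
    sub_nonneg.2 (mul_le_one₀ (hsq 0).2 (hsq 1).1 (hsq 1).2)
  have hr2 : r ^ 2 ≤ r := pow_le_of_le_one hr.1.le hr.2.le two_ne_zero
  calc
    _ ≤ c * ((1 - r ^ 2) * (1 - ‖x 0‖ ^ 2 * ‖x 1‖ ^ 2)) := by
      rw [mul_assoc, mul_comm (1 - _ : ℝ) (1 - r)]
      gcongr
    _ ≤ c * ((1 - r ^ 2 * ‖x 0‖ ^ 2) * (1 - r ^ 2 * ‖x 1‖ ^ 2)) :=
      mul_le_mul_of_nonneg_left (one_sub_mul_one_sub_mul_le (sq_nonneg r) (hsq 0) (hsq 1)) hc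
    _ ≤ ‖eval (r • x) q‖ ^ 2 - ‖eval (r • x) (reflection n m q)‖ ^ 2 := hb.le_radial hx hr
    _ ≤ ‖eval (r • x) q‖ ^ 2 := sub_le_self _ (sq_nonneg _)

/-- Along the radius to a zero off the torus, the right-hand side vanishes to second order but the
left-hand side only to first order. -/
theorem BidiskBound.eval_ne_zero_of_notMem_unitTorus (hc : 0 < c) (hb : BidiskBound n m q c)
    (hx : x ∈ closedBall 0 1) (hxT : x ∉ unitTorus 2) : eval x q ≠ 0 := by
  intro hqx
  have hgap : 0 < c * (1 - ‖x 0‖ ^ 2 * ‖x 1‖ ^ 2) :=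
    mul_pos hc (sub_pos.2 (norm_sq_mul_norm_sq_lt_one_of_notMem_unitTorus hx hxT))
  have hlim : Tendsto (fun r : ℝ => (1 - r) * (‖eval (r • x) q‖ ^ 2 / (r - 1) ^ 2)) (𝓝[<] 1)
      (𝓝 0) := by
    have hsecond := tendsto_norm_sq_div_sq_of_hasDerivAt
      (differentiableAt_eval_smul q x 1).hasDerivAt (by simpa using hqx)
    have hfirst : Tendsto (fun r : ℝ => 1 - r) (𝓝[<] 1) (𝓝 (1 - 1)) :=
      (Continuous.tendsto (by fun_prop) 1).mono_left nhdsWithin_le_nhds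
    simpa using hfirst.mul (hsecond.mono_left (nhdsLT_le_nhdsNE 1))
  refine hgap.not_ge (ge_of_tendsto hlim ?_)
  filter_upwards [Ioo_mem_nhdsLT zero_lt_one] with r hr
  have hr1 : 0 < 1 - r := sub_pos.2 hr.2
  have hfrac : (1 - r) * (‖eval (r • x) q‖ ^ 2 / (r - 1) ^ 2) =
      ‖eval (r • x) q‖ ^ 2 / (1 - r) := by
    rw [← neg_sub 1 r, neg_sq]
    field_simp
  rw [hfrac, le_div_iff₀ hr1]
  exact hb.mul_one_sub_le_norm_sq hc.le hx hr

/-- Along the radius to a zero on the torus, both sides vanish to second order, but the leading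
coefficients of `|q|²` and of the square modulus of its reflection cancel. -/
theorem BidiskBound.eval_ne_zero_of_mem_unitTorus (hz : q.degreeOf 0 ≤ n)
    (hw : q.degreeOf 1 ≤ m) (hc : 0 < c) (hb : BidiskBound n m q c) (hx : x ∈ unitTorus 2) :
    eval x q ≠ 0 := by
  intro hqx
  have hlim := (tendsto_norm_sq_sub_norm_sq_reflection (differentiableAt_eval_smul q x 1)
    (by simpa using hqx) (n + m)).mono_left (nhdsLT_le_nhdsNE 1)
  refine hc.not_ge (ge_of_tendsto hlim ?_)
  filter_upwards [Ioo_mem_nhdsLT zero_lt_one] with r hr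
  have hr1 : r - 1 ≠ 0 := (sub_neg.2 hr.2).ne
  rw [le_div_iff₀ (by positivity), ← norm_eval_smul_reflection hz hw hx hr.1.ne']
  refine le_trans ?_ (hb.le_radial (unitTorus_subset_closedBall hx) hr)
  simp only [norm_of_mem_unitTorus hx, one_pow, mul_one, ← sq]
  have hsq : (1 - r ^ 2) ^ 2 = (r - 1) ^ 2 * (1 + r) ^ 2 := by ring
  rw [hsq]
  gcongr
  exact le_mul_of_one_le_right (sq_nonneg _) (one_le_pow₀ (by linarith [hr.1]))

theorem BidiskBound.isStable (hz : q.degreeOf 0 ≤ n) (hw : q.degreeOf 1 ≤ m) (hc : 0 < c)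
    (hb : BidiskBound n m q c) : IsStable q := by
  refine isStable_iff.2 fun x hx => ?_
  by_cases hxT : x ∈ unitTorus 2
  · exact hb.eval_ne_zero_of_mem_unitTorus hz hw hc hxT
  · exact hb.eval_ne_zero_of_notMem_unitTorus hc hx hxT

end RadialLimit

theorem theorem1p1 (n m : ℕ) (hn : 0 < n) (hm : 0 < m) (q : MvPolynomial (Fin 2) ℂ)
    (hz : q.degreeOf 0 ≤ n) (hw : q.degreeOf 1 ≤ m) :
    (IsStable q ↔ ∃ c : ℝ, 0 < c ∧ BidiskBound n m q c) ∧
      (IsStable q → ∃ c : ℝ, 0 < c ∧ 1 / (c : ℂ) = torusMeanInv q ∧ BidiskBound n m q c) := by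
  have hbound := exists_bidiskBound_of_isStable (q := q) (by lia) hz hw
  refine ⟨⟨fun hq => ?_, fun ⟨c, hc, hb⟩ => hb.isStable hz hw hc⟩, hbound⟩
  obtain ⟨c, hc, -, hb⟩ := hbound hq
  exact ⟨c, hc, hb⟩
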